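/- A positive $\Diamond$-algebra is a pair $(L,\Diamond)$ where $L$ is a bounded distributive lattice and $\Diamond$ is a unary operation on $L$ with $\Diamond 0=0$ and $\Diamond(a\vee b)=\Diamond a\vee\Diamond b$ for all $a,b\in L$. Let $\mathsf{PMA}^\Diamond$ be the category of positive $\Diamond$-algebras and bounded lattice homomorphisms preserving $\Diamond$. A Priestley space is a compact topological space $X$ with a partial order $\le$ such that whenever $x\nleq y$ there is a clopen upset containing $x$ and missing $y$. A modal $\Diamond$-Priestley space is a pair $(X,R)$ where $X$ is a Priestley space and $R$ is a binary relation on $X$ such that $R[x]=\{y\mid xRy\}$ is a closed downset for each $x\in X$, and $\Diamond_R U=\{x\in X\mid xRy\text{ for some }y\in U\}$ is a clopen upset for each clopen upset $U$ of $X$. A p-morphism $f:(X,R)\to(X',R')$ is an order-preserving map such that (i) $xRz$ implies $f(x)R'f(z)$, and (ii) $f(x)R'y$ implies that there is $z\in X$ with $xRz$ and $y\le f(z)$. Let $\mathsf{MPS}^\Diamond$ be the category of modal $\Diamond$-Priestley spaces and continuous p-morphisms. Theorem (Goldblatt). The category $\mathsf{PMA}^\Diamond$ is dually equivalent to the category $\mathsf{MPS}^\Diamond$;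 that is, there is an equivalence of categories $(\mathsf{PMA}^\Diamond)^{\mathrm{op}}\simeq\mathsf{MPS}^\Diamond$. -/

import Mathlib

open CategoryTheory

universe u

/-- A positive `◇`-algebra: a bounded distributive lattice `L` with a unary operation `◇` such that
`◇ 0 = 0` and `◇ (a ∨ b) = ◇ a ∨ ◇ b`. -/
structure PosDiamondAlg where
  /-- the underlying bounded distributive lattice -/
  lat : BddDistLat.{u}
  /-- the operation `◇` -/
  dia : lat → lat
  dia_bot : dia ⊥ = ⊥
  dia_sup : ∀ a b : lat, dia a ⊔ dia b = dia (a ⊔ b)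

namespace PosDiamondAlg

/-- Morphisms: bounded lattice homomorphisms preserving `◇`. -/
@[ext]
structure Hom (A B : PosDiamondAlg.{u}) where
  /-- the underlying bounded lattice homomorphism -/
  hom : BoundedLatticeHom A.lat B.lat
  map_dia : ∀ a : A.lat, hom (A.dia a) = B.dia (hom a)

/-- The category `PMA^◇` of positive `◇`-algebras. -/
instance : Category PosDiamondAlg.{u} where
  Hom A B := Hom A B
  id A := ⟨BoundedLatticeHom.id A.lat, fun _ => rfl⟩
  comp f g := ⟨g.hom.comp f.hom, fun a => by
    simp only [BoundedLatticeHom.comp_apply, f.map_dia, g.map_dia]⟩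

end PosDiamondAlg

/-- For a binary relation `R` on `X` and `U ⊆ X`, the set `◇_R U = R⁻¹[U]`. -/
def relDiamond {X : Type u} (R : X → X → Prop) (U : Set X) : Set X :=
  {x | ∃ y, R x y ∧ y ∈ U}

/-- A modal `◇`-Priestley space: a Priestley space `X` (a compact ordered space satisfying the
Priestley separation axiom) with a binary relation `R` such that every `R[x]` is a closed downset
and `◇_R U` is a clopen upset for each clopen upset `U`. -/
structure ModalDiamondPriestley where
  /-- the underlying set of points -/
  carrier : Type u
  [top : TopologicalSpace carrier]
  [order : PartialOrder carrier]
  [compact : CompactSpace carrier]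
  [priestley : PriestleySpace carrier]
  /-- the accessibility relation -/
  R : carrier → carrier → Prop
  isClosed_R : ∀ x, IsClosed {y | R x y}
  isLowerSet_R : ∀ x, IsLowerSet {y | R x y}
  isClopen_diamond : ∀ U : Set carrier, IsClopen U → IsUpperSet U → IsClopen (relDiamond R U)
  isUpperSet_diamond : ∀ U : Set carrier, IsClopen U → IsUpperSet U → IsUpperSet (relDiamond R U)

namespace ModalDiamondPriestley

attribute [instance] top order compact priestley

/-- Morphisms: continuous p-morphisms. The map `hom` is continuous and order-preserving. -/
@[ext]
structure Hom (X Y : ModalDiamondPriestley.{u}) where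
  /-- the underlying continuous order-preserving map -/
  hom : X.carrier →Co Y.carrier
  map_rel : ∀ x z, X.R x z → Y.R (hom x) (hom z)
  lift_rel : ∀ x y, Y.R (hom x) y → ∃ z, X.R x z ∧ y ≤ hom z

/-- The category `MPS^◇` of modal `◇`-Priestley spaces. -/
instance : Category ModalDiamondPriestley.{u} where
  Hom X Y := Hom X Y
  id X := ⟨ContinuousOrderHom.id X.carrier, fun _ _ h => h, fun _ y h => ⟨y, h, le_rfl⟩⟩
  comp f g := ⟨g.hom.comp f.hom, fun x z h => g.map_rel _ _ (f.map_rel x z h), fun x y h => by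
    obtain ⟨w, hw, hyw⟩ := g.lift_rel (f.hom x) y h
    obtain ⟨z, hz, hwz⟩ := f.lift_rel x w hw
    exact ⟨z, hz, hyw.trans (g.hom.monotone' hwz)⟩⟩

end ModalDiamondPriestley

/-!
The duality sends a positive `◇`-algebra `A` to its space of prime filters, encoded as bounded
lattice homomorphisms `x : A → Bool`, ordered pointwise, topologized as a subspace of `A → Bool`,
and with `x R z` iff `z a` implies `x (◇ a)` for all `a`. Precomposition makes this a contravariant
functor `spectrum`, and the proof shows that it is faithful, full and essentially surjective.

Everything rests on two facts about the sets `supp a = {x | x a = true}`.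

* The prime filter theorem, in the form `PrimeSpec.exists_extending`. It shows that `a ↦ supp a` is
  injective (`supp_injective`), whence faithfulness. Since `{a | x (◇ a) = false}` is an ideal, it
  also produces `R`-successors of `x` containing any filter `F` with `x (◇ a)` for all `a ∈ F`
  (`exists_canonicalRel_of_filter`). For principal `F` this gives `◇_R (supp a) = supp (◇ a)`,
  so the spectrum is a modal space; for the filter generated by an image it gives the lifting
  condition for the maps of spectra.
* Compactness, which shows that every clopen upper set is some `supp a` (`exists_supp_eq`). Pulling
  the sets `supp a` back along a p-morphism of spectra thus defines a map of algebras, whence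
  fullness.

For a modal space `X`, the unit `X → spectrum (clopen upper sets of X)` sends `p` to
`{U | p ∈ U}`. It is an order embedding by Priestley separation and onto by compactness. It
preserves and reflects the relation because a closed lower set in a Priestley space is separated
from each point outside it by a clopen upper set (`exists_clopenUpperSet_disjoint`). A continuous
bijection of compact Hausdorff spaces is a homeomorphism, so the unit is an isomorphism.
-/

open Set Order

/-! ### The space of prime filters of a bounded distributive lattice -/

/-- The prime filters of a bounded distributive lattice, encoded by their characteristic functions:
bounded lattice homomorphisms to `Bool`. -/
def PrimeSpec (L : Type*) [DistribLattice L] [BoundedOrder L] : Type _ :=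
  BoundedLatticeHom L Bool

namespace PrimeSpec

variable {L : Type*} [DistribLattice L] [BoundedOrder L]

instance : FunLike (PrimeSpec L) L Bool :=
  inferInstanceAs (FunLike (BoundedLatticeHom L Bool) L Bool)

instance : BoundedLatticeHomClass (PrimeSpec L) L Bool :=
  inferInstanceAs (BoundedLatticeHomClass (BoundedLatticeHom L Bool) L Bool)

/-- Prime filters are ordered by inclusion. -/
instance : PartialOrder (PrimeSpec L) :=
  PartialOrder.lift (fun x : PrimeSpec L => (x : L → Bool)) DFunLike.coe_injective

/-- The topology generated by the sets `supp a` and their complements. -/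
instance : TopologicalSpace (PrimeSpec L) :=
  TopologicalSpace.induced (fun x : PrimeSpec L => (x : L → Bool)) inferInstance

@[ext]
theorem ext {x y : PrimeSpec L} (h : ∀ a, x a = y a) : x = y := DFunLike.ext x y h

theorem le_iff {x y : PrimeSpec L} : x ≤ y ↔ ∀ a, x a = true → y a = true := by
  change (∀ a, x a ≤ y a) ↔ _
  simp only [Bool.le_iff_imp]

theorem apply_sup (x : PrimeSpec L) (a b : L) : x (a ⊔ b) = (x a || x b) := map_sup x a b

theorem apply_inf (x : PrimeSpec L) (a b : L) : x (a ⊓ b) = (x a && x b) := map_inf x a b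

theorem apply_top (x : PrimeSpec L) : x ⊤ = true := map_top x

theorem apply_bot (x : PrimeSpec L) : x ⊥ = false := map_bot x

theorem apply_mono (x : PrimeSpec L) {a b : L} (h : a ≤ b) (ha : x a = true) : x b = true :=
  Bool.le_iff_imp.1 (OrderHomClass.mono x h) ha

/-- The set of prime filters containing `a`. -/
def supp (a : L) : Set (PrimeSpec L) := {x | x a = true}

@[simp]
theorem mem_supp {a : L} {x : PrimeSpec L} : x ∈ supp a ↔ x a = true := Iff.rfl

theorem continuous_apply (a : L) : Continuous fun x : PrimeSpec L => x a :=
  (_root_.continuous_apply a).comp continuous_induced_dom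

theorem isClopen_supp (a : L) : IsClopen (supp a) :=
  (isClopen_discrete {true}).preimage (continuous_apply a)

theorem isUpperSet_supp (a : L) : IsUpperSet (supp a) := fun _ _ h hx => le_iff.1 h a hx

instance : PriestleySpace (PrimeSpec L) where
  priestley {x y} h := by
    simp only [le_iff, not_forall] at h
    obtain ⟨a, hx, hy⟩ := h
    exact ⟨supp a, isClopen_supp a, isUpperSet_supp a, hx, hy⟩

instance : CompactSpace (PrimeSpec L) := by
  have hind : Topology.IsInducing (fun x : PrimeSpec L => (x : L → Bool)) := ⟨rfl⟩
  have hrange : range (fun x : PrimeSpec L => (x : L → Bool)) =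
      {g | g ⊤ = true} ∩ ({g | g ⊥ = false} ∩ ((⋂ a, ⋂ b, {g | g (a ⊔ b) = (g a || g b)}) ∩
        ⋂ a, ⋂ b, {g | g (a ⊓ b) = (g a && g b)})) := by
    ext g
    simp only [mem_inter_iff, mem_iInter, mem_ofPred_eq]
    constructor
    · rintro ⟨x, rfl⟩
      exact ⟨apply_top x, apply_bot x, apply_sup x, apply_inf x⟩
    · rintro ⟨ht, hb, hs, hi⟩
      exact ⟨(⟨⟨⟨g, hs⟩, hi⟩, ht, hb⟩ : BoundedLatticeHom L Bool), rfl⟩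
  have hor : Continuous fun p : Bool × Bool => (p.1 || p.2) := continuous_of_discreteTopology
  have hand : Continuous fun p : Bool × Bool => (p.1 && p.2) := continuous_of_discreteTopology
  have hev : ∀ a : L, Continuous fun g : L → Bool => g a := fun a => _root_.continuous_apply a
  have hclosed : IsClosed (range (fun x : PrimeSpec L => (x : L → Bool))) := by
    rw [hrange]
    exact (isClosed_eq (hev _) continuous_const).inter
      ((isClosed_eq (hev _) continuous_const).inter
        ((isClosed_iInter fun a => isClosed_iInter fun b =>
          isClosed_eq (hev _) (hor.comp ((hev a).prodMk (hev b)))).inter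
        (isClosed_iInter fun a => isClosed_iInter fun b =>
          isClosed_eq (hev _) (hand.comp ((hev a).prodMk (hev b))))))
  exact Topology.IsClosedEmbedding.compactSpace ⟨⟨hind, DFunLike.coe_injective⟩, hclosed⟩

/-- The prime filter theorem: disjoint filters and ideals are separated by a prime filter. -/
theorem exists_extending (F : PFilter L) (I : Ideal L) (h : Disjoint (F : Set L) (I : Set L)) :
    ∃ x : PrimeSpec L, (∀ a ∈ F, x a = true) ∧ ∀ a ∈ I, x a = false := by
  classical
  obtain ⟨J, hJ, hIJ, hFJ⟩ := DistribLattice.prime_ideal_of_disjoint_filter_ideal h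
  refine ⟨(⟨⟨⟨fun a => decide (a ∉ J), fun a b => ?_⟩, fun a b => ?_⟩, ?_, ?_⟩ :
    BoundedLatticeHom L Bool), fun a ha => ?_, fun a ha => ?_⟩
  · change decide (a ⊔ b ∉ J) = (decide (a ∉ J) || decide (b ∉ J))
    rw [← Bool.decide_or, decide_eq_decide, Ideal.sup_mem_iff]
    tauto
  · change decide (a ⊓ b ∉ J) = (decide (a ∉ J) && decide (b ∉ J))
    rw [← Bool.decide_and, decide_eq_decide, ← not_or, not_iff_not]
    exact ⟨hJ.mem_or_mem, fun h => h.elim (J.lower inf_le_left) (J.lower inf_le_right)⟩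
  · exact decide_eq_true hJ.toIsProper.top_notMem
  · exact decide_eq_false (not_not.2 J.bot_mem)
  · exact decide_eq_true (Set.disjoint_left.1 hFJ ha)
  · exact decide_eq_false (not_not.2 (hIJ ha))

theorem supp_subset_iff {a b : L} : supp a ⊆ supp b ↔ a ≤ b := by
  refine ⟨fun h => ?_, fun h x hx => apply_mono x h hx⟩
  by_contra hab
  obtain ⟨x, hF, hI⟩ := exists_extending (PFilter.principal a) (Ideal.principal b)
    (Set.disjoint_left.2 fun c hac hcb => hab (le_trans (PFilter.mem_principal.1 hac) hcb))
  have h1 : x b = true := h (hF a (PFilter.mem_principal.2 le_rfl))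
  have h2 : x b = false := hI b (Ideal.mem_principal.2 le_rfl)
  exact Bool.false_ne_true (h2.symm.trans h1)

theorem supp_injective : Function.Injective (supp : L → Set (PrimeSpec L)) := fun _ _ h =>
  le_antisymm (supp_subset_iff.1 h.subset) (supp_subset_iff.1 h.superset)

/-- Every clopen upper set is the set of prime filters containing some `a`. Compactness is used
twice: on the complement of `W` to squeeze some `supp a` between a point of `W` and `W`, and then
on `W`. -/
theorem exists_supp_eq {W : Set (PrimeSpec L)} (hW : IsClopen W) (hU : IsUpperSet W) :
    ∃ a, supp a = W := by
  have key : ∀ x ∈ W, ∃ a, x a = true ∧ supp a ⊆ W := by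
    intro x hx
    have : Nonempty {a : L // x a = true} := ⟨⟨⊤, apply_top x⟩⟩
    obtain ⟨a, ha⟩ := hW.compl.isClosed.isCompact.elim_directed_cover
      (fun a : {a : L // x a = true} => (supp a.1)ᶜ) (fun a => (isClopen_supp a.1).compl.isOpen)
      (fun y hy => by
        have hxy : ¬ x ≤ y := fun h => hy (hU h hx)
        simp only [le_iff, not_forall] at hxy
        obtain ⟨a, hxa, hya⟩ := hxy
        exact mem_iUnion.2 ⟨⟨a, hxa⟩, hya⟩)
      (fun a b => ⟨⟨a.1 ⊓ b.1, by rw [apply_inf, a.2, b.2]; rfl⟩,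
        compl_subset_compl.2 (supp_subset_iff.2 inf_le_left),
        compl_subset_compl.2 (supp_subset_iff.2 inf_le_right)⟩)
    exact ⟨a.1, a.2, compl_subset_compl.1 ha⟩
  have : Nonempty {a : L // supp a ⊆ W} :=
    ⟨⟨⊥, fun x hx => absurd ((apply_bot x).symm.trans hx) Bool.false_ne_true⟩⟩
  obtain ⟨a, ha⟩ := hW.isClosed.isCompact.elim_directed_cover
    (fun a : {a : L // supp a ⊆ W} => supp a.1) (fun a => (isClopen_supp a.1).isOpen)
    (fun x hx => by
      obtain ⟨a, hxa, ha⟩ := key x hx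
      exact mem_iUnion.2 ⟨⟨a, ha⟩, hxa⟩)
    (fun a b => ⟨⟨a.1 ⊔ b.1, fun x hx => by
      rw [mem_supp, apply_sup, Bool.or_eq_true] at hx
      exact hx.elim (fun h => a.2 h) (fun h => b.2 h)⟩,
      supp_subset_iff.2 le_sup_left, supp_subset_iff.2 le_sup_right⟩)
  exact ⟨a.1, a.2.antisymm ha⟩

end PrimeSpec

open PrimeSpec

/-! ### The modal space of a positive `◇`-algebra -/

namespace PosDiamondAlg

variable {A B : PosDiamondAlg.{u}}

theorem dia_mono {a b : A.lat} (h : a ≤ b) : A.dia a ≤ A.dia b := by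
  rw [← sup_eq_right, A.dia_sup, sup_eq_right.2 h]

/-- The canonical accessibility relation on prime filters: `z ⊆ ◇⁻¹ x`. -/
def canonicalRel (A : PosDiamondAlg.{u}) (x z : PrimeSpec A.lat) : Prop :=
  ∀ a, z a = true → x (A.dia a) = true

/-- A filter contained in `◇⁻¹ x` extends to a prime filter contained in `◇⁻¹ x`, because the
complement of `◇⁻¹ x` is an ideal. -/
theorem exists_canonicalRel_of_filter (x : PrimeSpec A.lat) (F : PFilter A.lat)
    (h : ∀ a ∈ F, x (A.dia a) = true) :
    ∃ z, A.canonicalRel x z ∧ ∀ a ∈ F, z a = true := by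
  have hI : IsIdeal {a : A.lat | x (A.dia a) = false} := by
    refine ⟨fun a b hba ha => ?_, ⟨⊥, ?_⟩, fun a ha b hb => ⟨a ⊔ b, ?_, le_sup_left, le_sup_right⟩⟩
    · rw [mem_ofPred_eq, ← Bool.not_eq_true] at ha ⊢
      exact fun hb => ha (apply_mono x (dia_mono hba) hb)
    · rw [mem_ofPred_eq, A.dia_bot, apply_bot]
    · rw [mem_ofPred_eq] at ha hb ⊢
      rw [← A.dia_sup, apply_sup, ha, hb]
      rfl
  obtain ⟨z, hz, hzI⟩ := exists_extending F hI.toIdeal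
    (Set.disjoint_left.2 fun a ha hb => Bool.false_ne_true (Eq.trans (Eq.symm hb) (h a ha)))
  refine ⟨z, fun a ha => ?_, hz⟩
  by_contra hx
  exact Bool.false_ne_true ((hzI a (Bool.eq_false_of_not_eq_true hx)).symm.trans ha)

theorem relDiamond_supp (a : A.lat) : relDiamond A.canonicalRel (supp a) = supp (A.dia a) := by
  ext x
  refine ⟨fun ⟨z, hz, ha⟩ => hz a ha, fun hx => ?_⟩
  obtain ⟨z, hz, hF⟩ := exists_canonicalRel_of_filter x (PFilter.principal a)
    fun b hb => apply_mono x (dia_mono (PFilter.mem_principal.1 hb)) hx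
  exact ⟨z, hz, hF a (PFilter.mem_principal.2 le_rfl)⟩

/-- The dual space of a positive `◇`-algebra. -/
def dualSpace (A : PosDiamondAlg.{u}) : ModalDiamondPriestley.{u} where
  carrier := PrimeSpec A.lat
  R := A.canonicalRel
  isClosed_R x := by
    simp only [canonicalRel, Set.ofPred_forall]
    refine isClosed_iInter fun a => ?_
    by_cases hx : x (A.dia a) = true
    · simp [hx]
    · simp only [hx, Bool.false_eq_true, imp_false]
      exact (isClopen_supp a).compl.isClosed
  isLowerSet_R _ _ _ hle hz a ha := hz a (le_iff.1 hle a ha)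
  isClopen_diamond U hU hU' := by
    obtain ⟨a, rfl⟩ := exists_supp_eq hU hU'
    rw [relDiamond_supp]
    exact isClopen_supp _
  isUpperSet_diamond U hU hU' := by
    obtain ⟨a, rfl⟩ := exists_supp_eq hU hU'
    rw [relDiamond_supp]
    exact isUpperSet_supp _

/-- The inverse image of prime filters under a homomorphism, as a continuous p-morphism. -/
noncomputable def dualMap (f : Hom A B) : ModalDiamondPriestley.Hom B.dualSpace A.dualSpace where
  hom :=
    { toFun := fun x => BoundedLatticeHom.comp (β := B.lat) x f.hom
      monotone' := fun _ _ h a => h (f.hom a)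
      continuous_toFun := continuous_induced_rng.2
        (continuous_pi fun a => PrimeSpec.continuous_apply (f.hom a)) }
  map_rel x z h a ha := by
    have := h (f.hom a) ha
    rwa [← f.map_dia] at this
  lift_rel x y h := by
    -- The filter of `B` generated by the image of `y` lies inside `◇⁻¹ x`.
    have hF : IsPFilter {b : B.lat | ∃ a : A.lat, DFunLike.coe (F := PrimeSpec A.lat) y a = true ∧
        f.hom a ≤ b} := by
      refine IsPFilter.of_def ⟨⊤, ⊤, apply_top _, le_top⟩ ?_
        fun {b c} hbc ⟨a, ha, hab⟩ => ⟨a, ha, hab.trans hbc⟩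
      rintro b ⟨a, ha, hab⟩ c ⟨a', ha', hac⟩
      refine ⟨b ⊓ c, ⟨a ⊓ a', ?_, ?_⟩, inf_le_left, inf_le_right⟩
      · exact (apply_inf (L := A.lat) y a a').trans (by rw [ha, ha']; rfl)
      · rw [map_inf]
        exact inf_le_inf hab hac
    obtain ⟨z, hz, hzF⟩ := exists_canonicalRel_of_filter (A := B) x hF.toPFilter (by
      rintro b ⟨a, ha, hab⟩
      refine apply_mono _ (dia_mono hab) ?_
      rw [← f.map_dia]
      exact h a ha)
    exact ⟨z, hz, le_iff.2 fun a ha => hzF _ ⟨a, ha, le_rfl⟩⟩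

/-- The contravariant functor sending a positive `◇`-algebra to its space of prime filters. -/
noncomputable def spectrum : PosDiamondAlg.{u}ᵒᵖ ⥤ ModalDiamondPriestley.{u} where
  obj A := A.unop.dualSpace
  map f := dualMap f.unop

instance : spectrum.{u}.Faithful where
  map_injective {A B} f g h := by
    refine Quiver.Hom.unop_inj (Hom.ext (DFunLike.ext _ _ fun a => supp_injective ?_))
    ext x
    have : (dualMap f.unop).hom x = (dualMap g.unop).hom x :=
      congrArg (fun k : ModalDiamondPriestley.Hom _ _ => k.hom x) h
    exact Bool.eq_iff_iff.1 (DFunLike.congr_fun (F := PrimeSpec _) this a)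

/-- A p-morphism of dual spaces comes from a homomorphism of algebras, which sends `a` to the
element representing the inverse image of `supp a`. -/
theorem exists_dualMap_eq (h : ModalDiamondPriestley.Hom B.dualSpace A.dualSpace) :
    ∃ f : Hom A B, dualMap f = h := by
  let k : PrimeSpec B.lat → PrimeSpec A.lat := h.hom
  have hk : Continuous k := h.hom.continuous_toFun
  have hmono : Monotone k := h.hom.monotone'
  have ex : ∀ a : A.lat, ∃ b : B.lat, supp b = k ⁻¹' supp a := fun a =>
    exists_supp_eq ((isClopen_supp a).preimage hk) ((isUpperSet_supp a).preimage hmono)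
  choose f hf using ex
  have hfx : ∀ a (x : PrimeSpec B.lat), x (f a) = k x a := fun a x =>
    Bool.eq_iff_iff.2 (Set.ext_iff.1 (hf a) x)
  have hext : ∀ {b c : B.lat}, (∀ x : PrimeSpec B.lat, x b = x c) → b = c := fun hbc =>
    supp_injective (Set.ext fun x => Bool.eq_iff_iff.1 (hbc x))
  refine ⟨⟨⟨⟨⟨f, fun a b => hext fun x => ?_⟩, fun a b => hext fun x => ?_⟩,
    hext fun x => ?_, hext fun x => ?_⟩, fun a => supp_injective ?_⟩, ?_⟩
  · simp only [apply_sup, hfx]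
  · simp only [apply_inf, hfx]
  · exact (hfx _ x).trans ((apply_top _).trans (apply_top x).symm)
  · exact (hfx _ x).trans ((apply_bot _).trans (apply_bot x).symm)
  · change supp (f (A.dia a)) = supp (B.dia (f a))
    rw [hf, ← relDiamond_supp, ← relDiamond_supp, hf]
    ext x
    constructor
    · rintro ⟨y, hy, hya⟩
      obtain ⟨z, hz, hyz⟩ := h.lift_rel x y hy
      exact ⟨z, hz, isUpperSet_supp a hyz hya⟩
    · rintro ⟨z, hz, hza⟩
      exact ⟨k z, h.map_rel x z hz, hza⟩
  · exact ModalDiamondPriestley.Hom.ext (ContinuousOrderHom.ext fun x =>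
      PrimeSpec.ext fun a => hfx a x)

instance : spectrum.{u}.Full where
  map_surjective h :=
    let ⟨f, hf⟩ := exists_dualMap_eq h
    ⟨Quiver.Hom.op f, hf⟩

end PosDiamondAlg

/-! ### The algebra of clopen upper sets of a modal space -/

instance {X : Type*} [TopologicalSpace X] [LE X] : DistribLattice (ClopenUpperSet X) :=
  .ofInfSupLe fun a b c => (Set.inter_union_distrib_left (a : Set X) b c).subset

/-- In a compact Priestley space, a closed lower set and a point outside it are separated by a
clopen upper set. -/
theorem exists_clopenUpperSet_disjoint {X : Type*} [TopologicalSpace X] [PartialOrder X]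
    [CompactSpace X] [PriestleySpace X] {C : Set X} (hC : IsClosed C) (hC' : IsLowerSet C) {z : X}
    (hz : z ∉ C) : ∃ U : ClopenUpperSet X, z ∈ U ∧ ∀ y ∈ C, y ∉ U := by
  have : Nonempty {U : ClopenUpperSet X // z ∈ U} := ⟨⟨⊤, mem_univ z⟩⟩
  obtain ⟨U, hU⟩ := hC.isCompact.elim_directed_cover
    (fun U : {U : ClopenUpperSet X // z ∈ U} => (U.1 : Set X)ᶜ)
    (fun U => U.1.isClopen.compl.isOpen)
    (fun y hy => by
      obtain ⟨U, hU, hU', hzU, hyU⟩ :=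
        exists_isClopen_upper_of_not_le (fun h : z ≤ y => hz (hC' h hy))
      exact mem_iUnion.2 ⟨⟨⟨⟨U, hU⟩, hU'⟩, hzU⟩, hyU⟩)
    (fun U V => ⟨⟨U.1 ⊓ V.1, U.2, V.2⟩, compl_subset_compl.2 inter_subset_left,
      compl_subset_compl.2 inter_subset_right⟩)
  exact ⟨U.1, U.2, hU⟩

namespace ModalDiamondPriestley

variable (X : ModalDiamondPriestley.{u})

/-- The dual algebra of a modal space: its clopen upper sets, with the operation `◇_R`. -/
def dualAlgebra : PosDiamondAlg.{u} where
  lat := BddDistLat.of (ClopenUpperSet X.carrier)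
  dia U := (⟨⟨relDiamond X.R (U : ClopenUpperSet X.carrier),
    X.isClopen_diamond _ (ClopenUpperSet.isClopen _) (ClopenUpperSet.upper _)⟩,
    X.isUpperSet_diamond _ (ClopenUpperSet.isClopen _) (ClopenUpperSet.upper _)⟩ :
      ClopenUpperSet X.carrier)
  dia_bot := ClopenUpperSet.ext (Set.eq_empty_of_forall_notMem fun _ ⟨_, _, h⟩ => h)
  dia_sup U V := ClopenUpperSet.ext (Set.ext fun x => by
    constructor
    · rintro (⟨y, hy, h⟩ | ⟨y, hy, h⟩)
      exacts [⟨y, hy, Or.inl h⟩, ⟨y, hy, Or.inr h⟩]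
    · rintro ⟨y, hy, h | h⟩
      exacts [Or.inl ⟨y, hy, h⟩, Or.inr ⟨y, hy, h⟩])

open Classical in
/-- The prime filter of the clopen upper sets containing a given point. -/
noncomputable def pointFilter (p : X.carrier) : PrimeSpec (ClopenUpperSet X.carrier) :=
  (⟨⟨⟨fun U => decide (p ∈ U), fun _ _ => (decide_eq_decide.2 Iff.rfl).trans (Bool.decide_or _ _)⟩,
    fun _ _ => (decide_eq_decide.2 Iff.rfl).trans (Bool.decide_and _ _)⟩,
    decide_eq_true (mem_univ p), decide_eq_false (notMem_empty p)⟩ :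
      BoundedLatticeHom (ClopenUpperSet X.carrier) Bool)

variable {X}

theorem pointFilter_apply {p : X.carrier} {U : ClopenUpperSet X.carrier} :
    X.pointFilter p U = true ↔ p ∈ U :=
  @decide_eq_true_iff _ (Classical.propDecidable _)

theorem pointFilter_le_iff {p q : X.carrier} : X.pointFilter p ≤ X.pointFilter q ↔ p ≤ q := by
  simp only [PrimeSpec.le_iff, pointFilter_apply]
  refine ⟨fun h => ?_, fun h U hp => U.upper h hp⟩
  by_contra hpq
  obtain ⟨U, hU, hU', hp, hq⟩ := exists_isClopen_upper_of_not_le hpq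
  exact hq (h ⟨⟨U, hU⟩, hU'⟩ hp)

theorem continuous_pointFilter : Continuous X.pointFilter := by
  refine continuous_induced_rng.2 (continuous_pi fun U => ?_)
  refine (continuous_bool_rng true).2 ?_
  convert U.isClopen using 1
  ext p
  exact pointFilter_apply

/-- Any point lying in all differences `U \ V` with `U` in the prime filter and `V` outside it
gives back the filter, and such a point exists by compactness. -/
theorem pointFilter_surjective : Function.Surjective X.pointFilter := by
  intro x
  let ι := {P : ClopenUpperSet X.carrier × ClopenUpperSet X.carrier //
    x P.1 = true ∧ x P.2 = false}
  have : Nonempty ι := ⟨⟨(⊤, ⊥), apply_top x, apply_bot x⟩⟩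
  have hclosed : ∀ i : ι, IsClosed ((i.1.1 : Set X.carrier) \ i.1.2) := fun i =>
    (i.1.1.isClopen.diff i.1.2.isClopen).isClosed
  obtain ⟨p, hp⟩ := IsCompact.nonempty_iInter_of_directed_nonempty_isCompact_isClosed
    (fun i : ι => (i.1.1 : Set X.carrier) \ i.1.2)
    (fun i j => ⟨⟨(i.1.1 ⊓ j.1.1, i.1.2 ⊔ j.1.2), by
        rw [apply_inf, i.2.1, j.2.1]; rfl, by rw [apply_sup, i.2.2, j.2.2]; rfl⟩,
      sdiff_subset_sdiff inter_subset_left subset_union_left,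
      sdiff_subset_sdiff inter_subset_right subset_union_right⟩)
    (fun i => by
      rw [Set.sdiff_nonempty]
      intro hle
      exact Bool.false_ne_true (i.2.2.symm.trans (apply_mono x hle i.2.1)))
    (fun i => (hclosed i).isCompact) hclosed
  rw [mem_iInter] at hp
  refine ⟨p, PrimeSpec.ext fun U => Bool.eq_iff_iff.2 (pointFilter_apply.trans ?_)⟩
  constructor
  · intro hU
    by_contra hx
    exact (hp ⟨(⊤, U), apply_top x, Bool.eq_false_of_not_eq_true hx⟩).2 hU
  · intro hx
    exact (hp ⟨(U, ⊥), hx, apply_bot x⟩).1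

theorem canonicalRel_pointFilter_iff {p q : X.carrier} :
    X.dualAlgebra.canonicalRel (X.pointFilter p) (X.pointFilter q) ↔ X.R p q := by
  constructor
  · intro h
    by_contra hpq
    obtain ⟨U, hqU, hU⟩ := exists_clopenUpperSet_disjoint (X.isClosed_R p) (X.isLowerSet_R p) hpq
    obtain ⟨y, hy, hyU⟩ := pointFilter_apply.1 (h U (pointFilter_apply.2 hqU))
    exact hU y hy hyU
  · exact fun h U hU => pointFilter_apply.2 ⟨q, h, pointFilter_apply.1 hU⟩

/-- A continuous surjection that preserves and reflects both the order and the relation is an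
isomorphism of modal spaces. -/
theorem nonempty_iso_of_surjective {X Y : ModalDiamondPriestley.{u}} (e : X.carrier → Y.carrier)
    (hcont : Continuous e) (hle : ∀ p q, e p ≤ e q ↔ p ≤ q) (hsurj : Function.Surjective e)
    (hR : ∀ p q, Y.R (e p) (e q) ↔ X.R p q) : Nonempty (X ≅ Y) := by
  have hinj : Function.Injective e := fun p q h =>
    le_antisymm ((hle p q).1 h.le) ((hle q p).1 h.ge)
  let E : X.carrier ≃ Y.carrier := Equiv.ofBijective e ⟨hinj, hsurj⟩
  have hE : ∀ y, e (E.symm y) = y := E.apply_symm_apply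
  have hE' : ∀ p, E.symm (e p) = p := E.symm_apply_apply
  have hinv : Continuous E.symm := Continuous.continuous_symm_of_equiv_compact_to_t2 (f := E) hcont
  have hRinv : ∀ x y, X.R (E.symm x) (E.symm y) ↔ Y.R x y := fun x y => by
    rw [← hR, hE, hE]
  let f : Hom X Y :=
    { hom := ⟨⟨e, fun p q h => (hle p q).2 h⟩, hcont⟩
      map_rel := fun p q h => (hR p q).2 h
      lift_rel := fun p y h => ⟨E.symm y, (hR _ _).1 ((hE y).symm ▸ h), (hE y).ge⟩ }
  let g : Hom Y X :=
    { hom := ⟨⟨E.symm, fun x y h => (hle _ _).1 (by rwa [hE, hE])⟩, hinv⟩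
      map_rel := fun x y h => (hRinv x y).2 h
      lift_rel := fun x p h => ⟨e p, (hRinv _ _).1 ((hE' p).symm ▸ h), (hE' p).ge⟩ }
  exact ⟨⟨f, g, Hom.ext (ContinuousOrderHom.ext hE'), Hom.ext (ContinuousOrderHom.ext hE)⟩⟩

end ModalDiamondPriestley

open ModalDiamondPriestley in
instance : PosDiamondAlg.spectrum.{u}.EssSurj where
  mem_essImage X :=
    ⟨Opposite.op X.dualAlgebra,
      (nonempty_iso_of_surjective (Y := X.dualAlgebra.dualSpace) X.pointFilter
        continuous_pointFilter (fun _ _ => pointFilter_le_iff) pointFilter_surjective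
        fun _ _ => canonicalRel_pointFilter_iff).map Iso.symm⟩

theorem mainTheorem11 : Nonempty (PosDiamondAlg.{u}ᵒᵖ ≌ ModalDiamondPriestley.{u}) := by
  have : PosDiamondAlg.spectrum.{u}.IsEquivalence := {}
  exact ⟨PosDiamondAlg.spectrum.asEquivalence⟩
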